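/- Let $n\ge 4$. Let $S_n$ be the group of permutations of $\{1,\dots,n\}$ (composed from right to left), and let $\mathbb{Z}^n\rtimes S_n$ be the semidirect product in which $S_n$ permutes the coordinates, $(s\cdot z)_i=z_{s^{-1}(i)}$; so $(z,s)(z',s')=(z+s\cdot z',\,ss')$. Then $\mathbb{Z}^n\rtimes S_n$ has the presentation with three generators $\sigma,\tau,\gamma$ and the defining relations $$\begin{aligned} &\sigma^2=e,\\ &(\sigma\tau\sigma\tau^{-1})^3=e,\\ &(\sigma\tau^m\sigma\tau^{-m})^2=e && (2\le m\le n-2),\\ &(\sigma\tau)^{n-1}=\tau^n,\\ &\gamma\,\tau^k\sigma\tau^{-k}=\tau^k\sigma\tau^{-k}\,\gamma && (0\le k\le n-3),\\ &\gamma\,\tau^l\gamma\tau^{-l}=\tau^l\gamma\tau^{-l}\,\gamma && (1\le l\le n-1). \end{aligned}$$ More precisely, there is an isomorphism from the group so presented onto $\mathbb{Z}^n\rtimes S_n$ that sends $\sigma$ to $(0,(1\,2))$, $\tau$ to $(0,c)$ where $c$ is the $n$-cycle $1\mapsto 2\mapsto\cdots\mapsto n\mapsto 1$, and $\gamma$ to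 $((0,\dots,0,1),\mathrm{id})$. -/

import Mathlib

/-- The three generating symbols of the presentation. -/
inductive Gen : Type
  | sigma
  | tau
  | gamma

/-- The relators, as words in the free group on `σ, τ, γ`; a relation `u = v` is encoded by the
word `u * v⁻¹`. -/
def relators (n : ℕ) : Set (FreeGroup Gen) :=
  let σ := FreeGroup.of Gen.sigma
  let τ := FreeGroup.of Gen.tau
  let γ := FreeGroup.of Gen.gamma
  {σ ^ 2} ∪
  {(σ * τ * σ * τ⁻¹) ^ 3} ∪
  {w | ∃ m : ℕ, 2 ≤ m ∧ m ≤ n - 2 ∧ w = (σ * τ ^ m * σ * (τ ^ m)⁻¹) ^ 2} ∪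
  {(σ * τ) ^ (n - 1) * (τ ^ n)⁻¹} ∪
  {w | ∃ k : ℕ, k ≤ n - 3 ∧
    w = (γ * τ ^ k * σ * (τ ^ k)⁻¹) * (τ ^ k * σ * (τ ^ k)⁻¹ * γ)⁻¹} ∪
  {w | ∃ l : ℕ, 1 ≤ l ∧ l ≤ n - 1 ∧
    w = (γ * τ ^ l * γ * (τ ^ l)⁻¹) * (τ ^ l * γ * (τ ^ l)⁻¹ * γ)⁻¹}

/-- `ℤⁿ ⋊ Sₙ`, with `ℤⁿ` written multiplicatively as `Fin n → Multiplicative ℤ`. A permutation `s`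
(composed right to left) acts on `ℤⁿ` by permuting coordinates, `(s • z) i = z (s⁻¹ i)`. -/
abbrev LatticeSemidirect (n : ℕ) : Type :=
  (Fin n → Multiplicative ℤ) ⋊[mulAutArrow] Equiv.Perm (Fin n)

/-! Put s_i = τ^i σ τ^{-i} for 0 ≤ i ≤ n-2. The relations in σ and τ give the s_i the Coxeter
relations of type A, and (στ)^{n-1} = τ^n says exactly that τ = s_0 s_1 ⋯ s_{n-2}. So σ and τ
generate a group of at most n! elements (`exists_finset_closure_subset_of_coxeter`). It maps onto
S_n, hence is a copy of S_n (`MooreRelations.exists_hom`), and τ^n = e follows.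

With coordinates numbered from 0, put x_i = τ^{i+1} γ τ^{-(i+1)} for 0 ≤ i < n, so that γ = x_{n-1}.
The last family of relations makes the x_i commute. Conjugation by τ shifts them cyclically;
conjugation by σ exchanges x_0 and x_1 and fixes the others (`conj_swap_zero`, `conj_swap_of_le`).
Thus S_n permutes the x_i like the basis of ℤⁿ, which yields a homomorphism from ℤⁿ ⋊ S_n to the
presented group. It is inverse to the evident map, as one sees on generators. -/

/-! ### Type A Coxeter relations: an upper bound for the order. -/

section CoxeterBound

variable {G : Type*} [Group G]

/-- The descending product `s k * s (k - 1) * ⋯` with `d` factors. -/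
def descendingProd (s : ℕ → G) (k : ℕ) : ℕ → G
  | 0 => 1
  | d + 1 => descendingProd s k d * s (k - d)

theorem descendingProd_mul_of_lt {s : ℕ → G} {k i d : ℕ}
    (hcomm : ∀ i j, i + 2 ≤ j → j ≤ k → Commute (s i) (s j)) (h : i + d < k) :
    descendingProd s k d * s i = s i * descendingProd s k d := by
  induction d with
  | zero => simp [descendingProd]
  | succ d ih =>
    rw [descendingProd, mul_assoc, ← (hcomm i (k - d) (by omega) (by omega)).eq, ← mul_assoc,
      ih (by omega), mul_assoc]

/-- Moving left, `s (i + 1)` commutes with the factors of index below `i` and then meets `s (i + 1)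
* s i`. The braid relation brings out `s i` on the left, which commutes with the remaining factors,
all of index at least `i + 2`. -/
theorem descendingProd_mul_of_gt {s : ℕ → G} {k i d : ℕ}
    (hbraid : ∀ i, i + 1 ≤ k → s i * s (i + 1) * s i = s (i + 1) * s i * s (i + 1))
    (hcomm : ∀ i j, i + 2 ≤ j → j ≤ k → Commute (s i) (s j))
    (hd : d ≤ k + 1) (hi : i + 1 ≤ k) (h : k < i + d) :
    descendingProd s k d * s (i + 1) = s i * descendingProd s k d := by
  induction d with
  | zero => omega
  | succ d ih =>
    rcases Nat.lt_or_ge k (i + d) with h' | h'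
    · rw [descendingProd, mul_assoc, (hcomm (k - d) (i + 1) (by omega) (by omega)).eq,
        ← mul_assoc, ih (by omega) h', mul_assoc]
    · obtain ⟨e, rfl⟩ : ∃ e, d = e + 1 := ⟨d - 1, by omega⟩
      have h1 : k - e = i + 1 := by omega
      have h2 : k - (e + 1) = i := by omega
      rw [descendingProd, descendingProd, h1, h2]
      calc descendingProd s k e * s (i + 1) * s i * s (i + 1)
          = descendingProd s k e * (s (i + 1) * s i * s (i + 1)) := by group
        _ = descendingProd s k e * s i * s (i + 1) * s i := by rw [← hbraid i hi]; group
        _ = s i * (descendingProd s k e * s (i + 1) * s i) := by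
          rw [descendingProd_mul_of_lt hcomm (by omega)]; group

/-- A group generated by `k` elements satisfying the Coxeter relations of type `A` has at most
`(k + 1)!` elements. -/
theorem exists_finset_closure_subset_of_coxeter {s : ℕ → G} (k : ℕ)
    (hsq : ∀ i < k, s i * s i = 1)
    (hbraid : ∀ i, i + 1 < k → s i * s (i + 1) * s i = s (i + 1) * s i * s (i + 1))
    (hcomm : ∀ i j, i + 2 ≤ j → j < k → Commute (s i) (s j)) :
    ∃ F : Finset G, F.card ≤ (k + 1).factorial ∧
      ∀ x ∈ Subgroup.closure (s '' Set.Iio k), x ∈ F := by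
  classical
  induction k with
  | zero => exact ⟨{1}, by simp, by simp⟩
  | succ k ih =>
    obtain ⟨F, hF, hmem⟩ := ih (fun i hi => hsq i (by omega)) (fun i hi => hbraid i (by omega))
      (fun i j hij hj => hcomm i j hij (by omega))
    have hcomm' : ∀ i j, i + 2 ≤ j → j ≤ k → Commute (s i) (s j) :=
      fun i j hij hj => hcomm i j hij (by omega)
    have hbraid' : ∀ i, i + 1 ≤ k → s i * s (i + 1) * s i = s (i + 1) * s i * s (i + 1) :=
      fun i hi => hbraid i (by omega)
    set H := Subgroup.closure (s '' Set.Iio k) with hH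
    have hs : ∀ i < k, s i ∈ H := fun i hi => Subgroup.subset_closure ⟨i, hi, rfl⟩
    refine ⟨(F ×ˢ Finset.range (k + 2)).image fun p => p.1 * descendingProd s k p.2, ?_, ?_⟩
    · refine Finset.card_image_le.trans ?_
      rw [Finset.card_product, Finset.card_range, Nat.factorial_succ (k + 1), mul_comm]
      exact Nat.mul_le_mul_left _ hF
    -- The `k + 2` cosets `H * descendingProd s k d` are stable under right multiplication by `s i`:
    -- the generator is absorbed into `H` if `i < k - d`, lengthens the product if `i = k - d`,
    -- cancels its last factor if `i = k - d + 1`, and otherwise enters `H` as `s (i - 1)`.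
    · have step : ∀ x, (∃ h ∈ H, ∃ d ≤ k + 1, x = h * descendingProd s k d) → ∀ i ≤ k,
          ∃ h ∈ H, ∃ d ≤ k + 1, x * s i = h * descendingProd s k d := by
        rintro _ ⟨h, hh, d, hd, rfl⟩ i hi
        rcases lt_trichotomy (i + d) k with hlt | heq | hgt
        · exact ⟨h * s i, H.mul_mem hh (hs i (by omega)), d, hd, by
            rw [mul_assoc, descendingProd_mul_of_lt hcomm' hlt, mul_assoc]⟩
        · refine ⟨h, hh, d + 1, by omega, ?_⟩
          rw [descendingProd, show k - d = i by omega, mul_assoc]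
        · rcases Nat.lt_or_ge (k + 1) (i + d) with h2 | h2
          · obtain ⟨j, rfl⟩ : ∃ j, i = j + 1 := ⟨i - 1, by omega⟩
            exact ⟨h * s j, H.mul_mem hh (hs j (by omega)), d, hd, by
              rw [mul_assoc, descendingProd_mul_of_gt hbraid' hcomm' hd hi (by omega), mul_assoc]⟩
          · obtain ⟨e, rfl⟩ : ∃ e, d = e + 1 := ⟨d - 1, by omega⟩
            refine ⟨h, hh, e, by omega, ?_⟩
            rw [descendingProd, show k - e = i by omega, mul_assoc, mul_assoc, hsq i (by omega),
              mul_one]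
      have key : ∀ x ∈ Subgroup.closure (s '' Set.Iio (k + 1)),
          ∃ h ∈ H, ∃ d ≤ k + 1, x = h * descendingProd s k d := by
        intro x hx
        induction hx using Subgroup.closure_induction_right with
        | one => exact ⟨1, H.one_mem, 0, by omega, by simp [descendingProd]⟩
        | mul_right x hx y hy ihx =>
          obtain ⟨i, hi, rfl⟩ := hy
          exact step x ihx i (Nat.lt_succ_iff.1 hi)
        | mul_inv_cancel x hx y hy ihx =>
          obtain ⟨i, hi, rfl⟩ := hy
          rw [inv_eq_of_mul_eq_one_left (hsq i hi)]
          exact step x ihx i (Nat.lt_succ_iff.1 hi)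
      intro x hx
      obtain ⟨h, hh, d, hd, rfl⟩ := key x hx
      exact Finset.mem_image.2 ⟨(h, d), Finset.mem_product.2
        ⟨hmem h hh, Finset.mem_range.2 (by omega)⟩, rfl⟩

end CoxeterBound

/-! ### The symmetric group, generated by a transposition and a long cycle. -/

section SymmetricGroup

variable {G : Type*} [Group G]

/-- The defining relations of the symmetric group `Sₙ` on a transposition `a` and an `n`-cycle
`t`. -/
structure MooreRelations (n : ℕ) (a t : G) : Prop where
  sq : a ^ 2 = 1
  braid : (a * t * a * t⁻¹) ^ 3 = 1
  comm : ∀ m, 2 ≤ m → m ≤ n - 2 → (a * t ^ m * a * (t ^ m)⁻¹) ^ 2 = 1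
  cycle : (a * t) ^ (n - 1) = t ^ n

/-- If a subgroup contains the first `m` conjugates of `a` by powers of `t`, then it contains
their product `(a t)ᵐ t⁻ᵐ`. -/
theorem mul_pow_mul_pow_inv_mem {a t : G} (K : Subgroup G) (m : ℕ)
    (h : ∀ i < m, t ^ i * a * (t ^ i)⁻¹ ∈ K) : (a * t) ^ m * (t ^ m)⁻¹ ∈ K := by
  induction m with
  | zero => simp
  | succ m ih =>
    have e : (a * t) ^ (m + 1) * (t ^ (m + 1))⁻¹ =
        ((a * t) ^ m * (t ^ m)⁻¹) * (t ^ m * a * (t ^ m)⁻¹) := by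
      rw [pow_succ (a * t), pow_succ t]; group
    rw [e]
    exact K.mul_mem (ih fun i hi => h i (by omega)) (h m (by omega))

theorem commute_of_mul_pow_two_eq_one {x y : G} (hx : x * x = 1) (hy : y * y = 1)
    (h : (x * y) ^ 2 = 1) : Commute x y := by
  have hx' := inv_eq_of_mul_eq_one_left hx
  have hy' := inv_eq_of_mul_eq_one_left hy
  rw [pow_two] at h
  have := inv_eq_of_mul_eq_one_left h
  rw [mul_inv_rev, hx', hy'] at this
  exact this.symm

theorem braid_of_mul_pow_three_eq_one {x y : G} (hx : x * x = 1) (hy : y * y = 1)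
    (h : (x * y) ^ 3 = 1) : x * y * x = y * x * y := by
  have hx' := inv_eq_of_mul_eq_one_left hx
  have hy' := inv_eq_of_mul_eq_one_left hy
  have h2 : (x * y * x) * (y * x * y) = 1 := by
    rw [← h]; simp only [pow_succ, pow_zero, one_mul, mul_assoc]
  have := eq_inv_of_mul_eq_one_left h2
  simpa only [mul_inv_rev, hx', hy', mul_assoc] using this

namespace MooreRelations

variable {n : ℕ} {a t : G}

theorem mul_self (h : MooreRelations n a t) : a * a = 1 := by rw [← pow_two, h.sq]

theorem conj_mul_self (h : MooreRelations n a t) (x : G) :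
    (x * a * x⁻¹) * (x * a * x⁻¹) = 1 := by
  calc (x * a * x⁻¹) * (x * a * x⁻¹) = x * (a * a) * x⁻¹ := by group
    _ = 1 := by rw [h.mul_self]; group

/-- Conjugation by `t ^ i` reduces this to `i = 0`, where `2 ≤ j - i ≤ n - 2` is the range of the
relation `comm`. -/
theorem conj_commute (h : MooreRelations n a t) {i j : ℕ} (hij : i + 2 ≤ j) (hj : j < n - 1) :
    Commute (t ^ i * a * (t ^ i)⁻¹) (t ^ j * a * (t ^ j)⁻¹) := by
  obtain ⟨m, rfl⟩ : ∃ m, j = i + m := ⟨j - i, by omega⟩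
  have h0 : Commute a (t ^ m * a * (t ^ m)⁻¹) := by
    refine commute_of_mul_pow_two_eq_one h.mul_self (h.conj_mul_self _) ?_
    simpa only [mul_assoc] using h.comm m (by omega) (by omega)
  rw [pow_add]
  generalize t ^ i = u
  have h1 := h0.map (MulAut.conj u).toMonoidHom
  simpa [mul_assoc] using h1

theorem conj_braid (h : MooreRelations n a t) (i : ℕ) :
    (t ^ i * a * (t ^ i)⁻¹) * (t ^ (i + 1) * a * (t ^ (i + 1))⁻¹) * (t ^ i * a * (t ^ i)⁻¹) =
      (t ^ (i + 1) * a * (t ^ (i + 1))⁻¹) * (t ^ i * a * (t ^ i)⁻¹) *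
        (t ^ (i + 1) * a * (t ^ (i + 1))⁻¹) := by
  have h0 : a * (t * a * t⁻¹) * a = (t * a * t⁻¹) * a * (t * a * t⁻¹) :=
    braid_of_mul_pow_three_eq_one h.mul_self (h.conj_mul_self _)
      (by simpa only [mul_assoc] using h.braid)
  rw [pow_succ]
  generalize t ^ i = u
  have h1 := congrArg (MulAut.conj u) h0
  simpa [mul_assoc] using h1

/-- The long cycle lies in the subgroup generated by the adjacent transpositions. -/
theorem cycle_mem_closure (h : MooreRelations n a t) (hn : 1 ≤ n) :
    t ∈ Subgroup.closure ((fun i => t ^ i * a * (t ^ i)⁻¹) '' Set.Iio (n - 1)) := by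
  have := mul_pow_mul_pow_inv_mem (a := a) (t := t)
    (Subgroup.closure ((fun i => t ^ i * a * (t ^ i)⁻¹) '' Set.Iio (n - 1))) (n - 1)
    (fun i hi => Subgroup.subset_closure ⟨i, hi, rfl⟩)
  -- The product of all the adjacent transpositions becomes `t ^ n * (t ^ (n - 1))⁻¹ = t`; `t ^ n =
  -- 1` is not needed.
  rw [h.cycle] at this
  have e : t ^ n * (t ^ (n - 1))⁻¹ = t := by
    obtain ⟨k, rfl⟩ : ∃ k, n = k + 1 := ⟨n - 1, by omega⟩
    rw [Nat.add_sub_cancel, pow_succ']; group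
  rwa [e] at this

end MooreRelations

theorem closure_swap_finRotate {n : ℕ} (hn : 2 ≤ n) :
    Subgroup.closure {finRotate n, Equiv.swap (⟨0, by omega⟩ : Fin n) ⟨1, by omega⟩} = ⊤ := by
  have := Equiv.Perm.closure_cycle_adjacent_swap (isCycle_finRotate_of_le hn)
    (support_finRotate_of_le hn) (⟨0, by omega⟩ : Fin n)
  obtain ⟨k, rfl⟩ : ∃ k, n = k + 1 := ⟨n - 1, by omega⟩
  rwa [finRotate_of_lt (by omega : 0 < k)] at this

/-- If `a`, `t` satisfy the Moore relations and map to the transposition and the cycle under some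
homomorphism to `Sₙ`, then that homomorphism splits on the subgroup they generate. -/
theorem MooreRelations.exists_hom {n : ℕ} (hn : 2 ≤ n) {a t : G} (h : MooreRelations n a t)
    (ρ : G →* Equiv.Perm (Fin n))
    (ha : ρ a = Equiv.swap (⟨0, by omega⟩ : Fin n) ⟨1, by omega⟩) (ht : ρ t = finRotate n) :
    ∃ φ : Equiv.Perm (Fin n) →* G,
      φ (Equiv.swap (⟨0, by omega⟩ : Fin n) ⟨1, by omega⟩) = a ∧ φ (finRotate n) = t := by
  set H := Subgroup.closure ((fun i => t ^ i * a * (t ^ i)⁻¹) '' Set.Iio (n - 1)) with hH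
  have htH : t ∈ H := h.cycle_mem_closure (by omega)
  have haH : a ∈ H := Subgroup.subset_closure ⟨0, by simp; omega, by simp⟩
  obtain ⟨F, hF, hmem⟩ := exists_finset_closure_subset_of_coxeter
    (s := fun i => t ^ i * a * (t ^ i)⁻¹) (n - 1) (fun i _ => h.conj_mul_self _)
    (fun i _ => h.conj_braid i) (fun i j hij hj => h.conj_commute hij hj)
  have hfin : Finite H := Finite.of_injective (β := F) (fun x => ⟨x.1, hmem x.1 x.2⟩)
    (fun x y hxy => Subtype.ext (congrArg (fun z : F => z.1) hxy))
  have hcard : Nat.card H ≤ Nat.card (Equiv.Perm (Fin n)) := by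
    have h1 : Nat.card H ≤ Nat.card F := Nat.card_le_card_of_injective
      (fun x : H => (⟨x.1, hmem x.1 x.2⟩ : F))
      (fun x y hxy => Subtype.ext (congrArg (fun z : F => z.1) hxy))
    rw [Nat.card_eq_fintype_card (α := F), Fintype.card_coe] at h1
    rw [Nat.sub_add_cancel (by omega)] at hF
    rw [Nat.card_perm, Nat.card_fin]
    exact h1.trans hF
  set r : H →* Equiv.Perm (Fin n) := ρ.comp H.subtype with hr
  have hra : r ⟨a, haH⟩ = Equiv.swap (⟨0, by omega⟩ : Fin n) ⟨1, by omega⟩ := ha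
  have hrt : r ⟨t, htH⟩ = finRotate n := ht
  -- Since `H` has at most `n!` elements, surjectivity onto `Sₙ` already forces bijectivity.
  have hsurj : Function.Surjective r := by
    rw [← MonoidHom.range_eq_top, eq_top_iff, ← closure_swap_finRotate hn, Subgroup.closure_le]
    rintro _ (rfl | rfl)
    · exact ⟨_, hrt⟩
    · exact ⟨_, hra⟩
  let e := MulEquiv.ofBijective r (hsurj.bijective_of_nat_card_le hcard)
  refine ⟨H.subtype.comp e.symm.toMonoidHom, ?_, ?_⟩
  · have : e.symm (Equiv.swap (⟨0, by omega⟩ : Fin n) ⟨1, by omega⟩) = ⟨a, haH⟩ :=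
      e.symm_apply_eq.2 hra.symm
    simp [this]
  · have : e.symm (finRotate n) = ⟨t, htH⟩ := e.symm_apply_eq.2 hrt.symm
    simp [this]

end SymmetricGroup

theorem mulAutArrow_mulSingle {n : ℕ} (s : Equiv.Perm (Fin n)) (i : Fin n)
    (z : Multiplicative ℤ) :
    (mulAutArrow s : MulAut (Fin n → Multiplicative ℤ)) (Pi.mulSingle i z) =
      Pi.mulSingle (s i) z := by
  ext j
  change (Pi.mulSingle i z : Fin n → Multiplicative ℤ) (s⁻¹ j) =
    (Pi.mulSingle (s i) z : Fin n → Multiplicative ℤ) j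
  simp only [Pi.mulSingle_apply, Equiv.Perm.inv_eq_iff_eq]

/-! ### The commuting conjugates of `g` and the action of `Sₙ` on them. -/

section WreathProduct

variable {G : Type*} [Group G]

/-- The relations between the generators of `Sₙ` and a generator of `ℤⁿ`. -/
structure TranslationRelations (n : ℕ) (a t g : G) : Prop where
  comm : ∀ k ≤ n - 3, Commute g (t ^ k * a * (t ^ k)⁻¹)
  conj_comm : ∀ l, 1 ≤ l → l ≤ n - 1 → Commute g (t ^ l * g * (t ^ l)⁻¹)

namespace TranslationRelations

variable {n : ℕ} {a t g : G}

/-- `g` commutes with the conjugates of `a` by `t ^ k`, `k ≤ n - 3`, hence with their product `(a *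
t) ^ (n - 2) * (t ^ (n - 2))⁻¹`, which the cycle relation turns into `t⁻¹ * a⁻¹ * t ^ 2`. -/
theorem conj_swap_zero (hn : 3 ≤ n) (h : MooreRelations n a t) (hg : TranslationRelations n a t g) :
    a * (t ^ 1 * g * (t ^ 1)⁻¹) * a⁻¹ = t ^ 2 * g * (t ^ 2)⁻¹ := by
  have h1 := mul_pow_mul_pow_inv_mem (a := a) (t := t) (Subgroup.centralizer {g}) (n - 2)
    (fun i hi => Subgroup.mem_centralizer_singleton_iff.2 (hg.comm i (by omega)).symm)
  have e : (a * t) ^ (n - 2) * (t ^ (n - 2))⁻¹ = t⁻¹ * a⁻¹ * t ^ 2 := by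
    have h2 := h.cycle
    obtain ⟨k, rfl⟩ : ∃ k, n = k + 2 := ⟨n - 2, by omega⟩
    rw [show k + 2 - 1 = k + 1 by omega, pow_succ'] at h2
    rw [Nat.add_sub_cancel, ← inv_mul_eq_iff_eq_mul.2 h2.symm, pow_add t k 2,
      (Commute.pow_pow_self t k 2).eq]
    group
  rw [e, Subgroup.mem_centralizer_singleton_iff] at h1
  have h3 : g = (t⁻¹ * a⁻¹ * t ^ 2) * g * (t⁻¹ * a⁻¹ * t ^ 2)⁻¹ := by rw [h1]; group
  conv_lhs => rw [h3]
  group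

/-- As `t ^ n = 1`, conjugating `a` by `(t ^ (i + 1))⁻¹` is conjugating it by `t ^ (n - (i + 1))`,
and `i ≥ 2` puts this exponent in the range `k ≤ n - 3`. -/
theorem conj_swap_of_le (hn : 3 ≤ n) (ht : t ^ n = 1) (hg : TranslationRelations n a t g) {i : ℕ}
    (hi : 2 ≤ i) (hin : i < n) :
    a * (t ^ (i + 1) * g * (t ^ (i + 1))⁻¹) * a⁻¹ = t ^ (i + 1) * g * (t ^ (i + 1))⁻¹ := by
  have h1 := (hg.comm (n - (i + 1)) (by omega)).eq
  have e : t ^ (n - (i + 1)) = (t ^ (i + 1))⁻¹ := by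
    rw [eq_inv_iff_mul_eq_one, ← pow_add, Nat.sub_add_cancel hin, ht]
  rw [e, inv_inv] at h1
  generalize t ^ (i + 1) = u at *
  have h2 : g = (u⁻¹ * a * u) * g * (u⁻¹ * a * u)⁻¹ := by rw [← h1]; group
  conv_rhs => rw [h2]
  group

end TranslationRelations

theorem val_finRotate {n : ℕ} (i : Fin n) : (finRotate n i : ℕ) = (i + 1) % n := by
  obtain ⟨k, rfl⟩ : ∃ k, n = k + 1 := ⟨n - 1, by have := i.2; omega⟩
  rw [coe_finRotate]
  split_ifs with h
  · simp [h]
  · have : (i : ℕ) ≠ k := fun h' => h (Fin.ext h')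
    rw [Nat.mod_eq_of_lt (by omega)]

theorem val_finRotate_pow {n : ℕ} (i : Fin n) (k : ℕ) :
    ((finRotate n ^ k) i : ℕ) = (i + k) % n := by
  induction k with
  | zero => simp [Nat.mod_eq_of_lt i.2]
  | succ k ih => rw [pow_succ', Equiv.Perm.mul_apply, val_finRotate, ih]; simp [add_assoc]

theorem finRotate_pow_self (n : ℕ) : finRotate n ^ n = 1 := by
  ext i
  rw [val_finRotate_pow]
  simp [Nat.mod_eq_of_lt i.2]

/-- Conjugation by the image of a permutation permutes the translates of `g`. -/
theorem TranslationRelations.conj_apply {n : ℕ} (hn : 3 ≤ n) {a t g : G}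
    (h : MooreRelations n a t) (hg : TranslationRelations n a t g)
    (φ : Equiv.Perm (Fin n) →* G)
    (ha : φ (Equiv.swap (⟨0, by omega⟩ : Fin n) ⟨1, by omega⟩) = a) (ht : φ (finRotate n) = t)
    (s : Equiv.Perm (Fin n)) (i : Fin n) :
    φ s * (t ^ (i + 1 : ℕ) * g * (t ^ (i + 1 : ℕ))⁻¹) * (φ s)⁻¹ =
      t ^ (s i + 1 : ℕ) * g * (t ^ (s i + 1 : ℕ))⁻¹ := by
  have htn : t ^ n = 1 := by rw [← ht, ← map_pow, finRotate_pow_self, map_one]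
  have hs : s ∈ Subgroup.closure
      {finRotate n, Equiv.swap (⟨0, by omega⟩ : Fin n) ⟨1, by omega⟩} := by
    rw [closure_swap_finRotate (by omega)]; trivial
  induction hs using Subgroup.closure_induction generalizing i with
  | one => simp
  | mul x y _ _ hx hy =>
    rw [Equiv.Perm.mul_apply, ← hx, ← hy, map_mul]; group
  | inv x _ hx =>
    have := hx (x⁻¹ i)
    rw [← Equiv.Perm.mul_apply, mul_inv_cancel, Equiv.Perm.one_apply] at this
    rw [← this, map_inv]; group
  | mem x hx =>
    rcases hx with rfl | rfl
    · rw [ht, val_finRotate]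
      rcases Nat.lt_or_ge (i + 1) n with hi | hi
      · rw [Nat.mod_eq_of_lt hi, pow_succ' t (i + 1)]; group
      · have hi' : (i : ℕ) + 1 = n := by omega
        rw [hi', htn, Nat.mod_self]; simp
    · rw [ha]
      have h0 := hg.conj_swap_zero hn h
      have n0 : 0 < n := by omega
      have n1 : 1 < n := by omega
      rcases Nat.lt_or_ge i 2 with hi | hi
      · rcases Nat.lt_or_ge i 1 with hi1 | hi1
        · obtain rfl : i = ⟨0, n0⟩ := Fin.ext (by simp; omega)
          rw [Equiv.swap_apply_left]; exact h0
        · obtain rfl : i = ⟨1, n1⟩ := Fin.ext (by simp; omega)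
          rw [Equiv.swap_apply_right]
          show a * (t ^ 2 * g * (t ^ 2)⁻¹) * a⁻¹ = t ^ 1 * g * (t ^ 1)⁻¹
          rw [← h0]
          have e : a⁻¹ = a := inv_eq_of_mul_eq_one_left h.mul_self
          have e2 : a * (a * (t ^ 1 * g * (t ^ 1)⁻¹) * a⁻¹) * a⁻¹ =
            (a * a) * (t ^ 1 * g * (t ^ 1)⁻¹) * (a * a)⁻¹ := by group
          rw [e2, h.mul_self]; simp
      · rw [Equiv.swap_apply_of_ne_of_ne (by simp [Fin.ext_iff]; omega)
          (by simp [Fin.ext_iff]; omega)]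
        exact hg.conj_swap_of_le hn htn hi i.2

theorem TranslationRelations.commute_translates {n : ℕ} {a t g : G}
    (hg : TranslationRelations n a t g) {i j : ℕ} (hij : i < j) (hj : j < n) :
    Commute (t ^ (i + 1) * g * (t ^ (i + 1))⁻¹) (t ^ (j + 1) * g * (t ^ (j + 1))⁻¹) := by
  obtain ⟨l, rfl⟩ : ∃ l, j = i + l := ⟨j - i, by omega⟩
  have h0 := hg.conj_comm l (by omega) (by omega)
  rw [show i + l + 1 = (i + 1) + l by omega, pow_add t (i + 1)]
  generalize t ^ (i + 1) = u
  have h1 := h0.map (MulAut.conj u).toMonoidHom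
  simpa [mul_assoc] using h1

/-- Elements satisfying the relations define a homomorphism from `ℤⁿ ⋊ Sₙ`. -/
theorem TranslationRelations.exists_hom {n : ℕ} (hn : 3 ≤ n) {a t g : G}
    (h : MooreRelations n a t) (hg : TranslationRelations n a t g)
    (φ : Equiv.Perm (Fin n) →* G)
    (ha : φ (Equiv.swap (⟨0, by omega⟩ : Fin n) ⟨1, by omega⟩) = a) (ht : φ (finRotate n) = t) :
    ∃ Ψ : LatticeSemidirect n →* G, (∀ s, Ψ (SemidirectProduct.inr s) = φ s) ∧
      ∀ i : Fin n, Ψ (SemidirectProduct.inl (Pi.mulSingle i (Multiplicative.ofAdd (1 : ℤ)))) =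
        t ^ (i + 1 : ℕ) * g * (t ^ (i + 1 : ℕ))⁻¹ := by
  -- The exponent `i + 1` makes the last translate equal to `g`, because `t ^ n = 1`.
  set x : Fin n → G := fun i => t ^ (i + 1 : ℕ) * g * (t ^ (i + 1 : ℕ))⁻¹ with hx
  have hcomm : Pairwise fun i j => ∀ y z : Multiplicative ℤ,
      Commute (zpowersHom G (x i) y) (zpowersHom G (x j) z) := by
    intro i j hij y z
    have hc : Commute (x i) (x j) := by
      rcases lt_or_gt_of_ne hij with h' | h'
      · exact hg.commute_translates h' j.2
      · exact (hg.commute_translates h' i.2).symm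
    simpa [zpowersHom_apply] using hc.zpow_zpow _ _
  set ψ := MonoidHom.noncommPiCoprod (fun i => zpowersHom G (x i)) hcomm with hψ
  have hψs : ∀ i z, ψ (Pi.mulSingle i z) = x i ^ (Multiplicative.toAdd z) := fun i z => by
    rw [hψ, MonoidHom.noncommPiCoprod_mulSingle, zpowersHom_apply]
  refine ⟨SemidirectProduct.lift ψ φ fun s => ?_, fun s => SemidirectProduct.lift_inr _ _ _ _,
    fun i => ?_⟩
  · refine MonoidHom.pi_ext fun i z => ?_
    have e : (mulAutArrow s : MulAut (Fin n → Multiplicative ℤ)) (Pi.mulSingle i z) =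
        Pi.mulSingle (s i) z := mulAutArrow_mulSingle s i z
    simp only [MonoidHom.comp_apply, MulEquiv.coe_toMonoidHom, MulAut.conj_apply]
    rw [e, hψs, hψs, ← conj_zpow]
    congr 1
    exact (hg.conj_apply hn h φ ha ht s i).symm
  · rw [SemidirectProduct.lift_inl, hψs]; simp [hx]

end WreathProduct

/-! ### Verification of the relations, and the isomorphism. -/

section Presentation

theorem finRotate_pow_mul_swap_mul {n : ℕ} (hn : 2 ≤ n) {k : ℕ} (hk : k + 1 < n) :
    finRotate n ^ k * Equiv.swap (⟨0, by omega⟩ : Fin n) ⟨1, by omega⟩ * (finRotate n ^ k)⁻¹ =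
      Equiv.swap ⟨k, by omega⟩ ⟨k + 1, hk⟩ := by
  rw [← Equiv.swap_apply_apply]
  congr 1 <;> ext <;> rw [val_finRotate_pow]
  · simpa using Nat.mod_eq_of_lt (by omega : k < n)
  · simpa [add_comm] using Nat.mod_eq_of_lt hk

/-- The product fixes the point 0 and permutes the other `n - 1` points cyclically. -/
theorem swap_mul_finRotate_pow {n : ℕ} (hn : 2 ≤ n) :
    (Equiv.swap (⟨0, by omega⟩ : Fin n) ⟨1, by omega⟩ * finRotate n) ^ (n - 1) = 1 := by
  set p := Equiv.swap (⟨0, by omega⟩ : Fin n) ⟨1, by omega⟩ * finRotate n with hp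
  have h0 : p ⟨0, by omega⟩ = ⟨0, by omega⟩ := by
    have : finRotate n ⟨0, by omega⟩ = ⟨1, by omega⟩ :=
      Fin.ext (by rw [val_finRotate]; exact Nat.mod_eq_of_lt (show 0 + 1 < n by omega))
    rw [hp, Equiv.Perm.mul_apply, this, Equiv.swap_apply_right]
  have h1 : ∀ i : Fin n, 0 < (i : ℕ) → (p i : ℕ) = i % (n - 1) + 1 := by
    intro i hi
    rw [hp, Equiv.Perm.mul_apply]
    have hv := val_finRotate i
    rcases Nat.lt_or_ge (i + 1) n with h | h
    · rw [Nat.mod_eq_of_lt h] at hv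
      rw [Equiv.swap_apply_of_ne_of_ne (by simp only [ne_eq, Fin.ext_iff]; omega)
        (by simp only [ne_eq, Fin.ext_iff]; omega), hv, Nat.mod_eq_of_lt (by omega)]
    · have hi' : (i : ℕ) = n - 1 := by omega
      have : finRotate n i = ⟨0, by omega⟩ := by
        refine Fin.ext ?_
        rw [hv, hi', Nat.sub_add_cancel (by omega)]; simp
      rw [this, Equiv.swap_apply_left, hi', Nat.mod_self]
  have h2 : ∀ (m : ℕ) (i : Fin n), 0 < (i : ℕ) → ((p ^ m) i : ℕ) = (i - 1 + m) % (n - 1) + 1 := by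
    intro m i hi
    induction m with
    | zero =>
      rw [pow_zero, Equiv.Perm.one_apply, Nat.add_zero, Nat.mod_eq_of_lt (by omega)]; omega
    | succ m ih =>
      rw [pow_succ', Equiv.Perm.mul_apply, h1 _ (by omega), ih]
      simp [add_assoc]
  ext i
  rw [Equiv.Perm.one_apply]
  rcases Nat.eq_zero_or_pos (i : ℕ) with hi | hi
  · obtain rfl : i = ⟨0, lt_of_lt_of_le two_pos hn⟩ := Fin.ext hi
    rw [Equiv.Perm.pow_apply_eq_self_of_apply_eq_self h0]
  · rw [h2 _ i hi, Nat.add_mod_right, Nat.mod_eq_of_lt (by omega)]; omega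

theorem mooreRelations_perm {n : ℕ} (hn : 3 ≤ n) :
    MooreRelations n (Equiv.swap (⟨0, by omega⟩ : Fin n) ⟨1, by omega⟩) (finRotate n) where
  sq := by rw [pow_two, Equiv.swap_mul_self]
  braid := by
    have e := finRotate_pow_mul_swap_mul (n := n) (k := 1) (by omega) (by omega)
    rw [pow_one] at e
    -- Both transpositions are written with their common point 1 first, so that their product is
    -- recognised as a 3-cycle.
    rw [mul_assoc, mul_assoc, ← mul_assoc (finRotate n), e,
      Equiv.swap_comm (⟨0, by omega⟩ : Fin n)]
    have h3 := (Equiv.Perm.isThreeCycle_swap_mul_swap_same (a := (⟨1, by omega⟩ : Fin n))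
      (b := ⟨0, by omega⟩) (c := ⟨1 + 1, by omega⟩) (by simp) (by simp) (by simp)).orderOf
    rw [← h3]
    exact pow_orderOf_eq_one _
  comm m hm hmn := by
    rw [mul_assoc, mul_assoc, ← mul_assoc (finRotate n ^ m),
      finRotate_pow_mul_swap_mul (by omega) (by omega)]
    have hc : Commute (Equiv.swap (⟨0, by omega⟩ : Fin n) ⟨1, by omega⟩)
        (Equiv.swap (⟨m, by omega⟩ : Fin n) ⟨m + 1, by omega⟩) :=
      (Equiv.Perm.disjoint_swap_swap (by
        simp only [List.nodup_cons, List.mem_cons, Fin.ext_iff, List.not_mem_nil, not_or,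
          List.nodup_nil, not_false_eq_true, and_true]
        omega)).commute
    rw [hc.mul_pow, pow_two, pow_two, Equiv.swap_mul_self, Equiv.swap_mul_self, one_mul]
  cycle := by rw [swap_mul_finRotate_pow (by omega), finRotate_pow_self]

theorem MooreRelations.map {G H : Type*} [Group G] [Group H] {n : ℕ} {a t : G}
    (h : MooreRelations n a t) (f : G →* H) : MooreRelations n (f a) (f t) where
  sq := by rw [← map_pow, h.sq, map_one]
  braid := by simpa using congrArg f h.braid
  comm m hm hmn := by simpa using congrArg f (h.comm m hm hmn)
  cycle := by simpa using congrArg f h.cycle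

theorem inr_mul_inl_mulSingle_mul {n : ℕ} (s : Equiv.Perm (Fin n)) (i : Fin n)
    (z : Multiplicative ℤ) :
    (SemidirectProduct.inr s * SemidirectProduct.inl (Pi.mulSingle i z) *
      (SemidirectProduct.inr s)⁻¹ : LatticeSemidirect n) =
      SemidirectProduct.inl (Pi.mulSingle (s i) z) := by
  rw [← mulAutArrow_mulSingle, SemidirectProduct.inl_aut, map_inv]

theorem translationRelations_latticeSemidirect {n : ℕ} (hn : 3 ≤ n) :
    TranslationRelations (G := LatticeSemidirect n) n
      (SemidirectProduct.inr (Equiv.swap (⟨0, by omega⟩ : Fin n) ⟨1, by omega⟩))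
      (SemidirectProduct.inr (finRotate n))
      (SemidirectProduct.inl
        (Pi.mulSingle (⟨n - 1, by omega⟩ : Fin n) (Multiplicative.ofAdd (1 : ℤ)))) where
  comm k hk := by
    rw [← map_pow, ← map_mul, ← map_inv, ← map_mul,
      finRotate_pow_mul_swap_mul (by omega) (by omega)]
    refine (mul_inv_eq_iff_eq_mul.1 ?_ : _ = _).symm
    -- From `k ≤ n - 3`, the transposition of `k` and `k + 1` misses the coordinate `n - 1`.
    rw [inr_mul_inl_mulSingle_mul, Equiv.swap_apply_of_ne_of_ne
      (by simp only [ne_eq, Fin.ext_iff]; omega) (by simp only [ne_eq, Fin.ext_iff]; omega)]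
  conj_comm l _ _ := by
    rw [← map_pow, inr_mul_inl_mulSingle_mul]
    exact (Commute.all _ _).map SemidirectProduct.inl

/-- The values of the three generators determined by three elements of a group. -/
def Gen.values {G : Type*} (a t g : G) : Gen → G
  | .sigma => a
  | .tau => t
  | .gamma => g

theorem lift_relators_eq_one {G : Type*} [Group G] {n : ℕ} {a t g : G}
    (h : MooreRelations n a t) (hg : TranslationRelations n a t g) :
    ∀ r ∈ relators n, FreeGroup.lift (Gen.values a t g) r = 1 := by
  rintro r (((((hr | hr) | hr) | hr) | hr) | hr)
  · rw [Set.mem_singleton_iff.1 hr]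
    simpa [Gen.values] using h.sq
  · rw [Set.mem_singleton_iff.1 hr]
    simpa [Gen.values] using h.braid
  · obtain ⟨m, hm, hmn, rfl⟩ := hr
    simpa [Gen.values] using h.comm m hm hmn
  · rw [Set.mem_singleton_iff.1 hr]
    simpa [Gen.values, mul_inv_eq_one] using h.cycle
  · obtain ⟨k, hk, rfl⟩ := hr
    rw [map_mul, map_inv, mul_inv_eq_one]
    simpa [Gen.values, mul_assoc] using (hg.comm k hk).eq
  · obtain ⟨l, hl, hln, rfl⟩ := hr
    rw [map_mul, map_inv, mul_inv_eq_one]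
    simpa [Gen.values, mul_assoc] using (hg.conj_comm l hl hln).eq

theorem mooreRelations_presentedGroup (n : ℕ) :
    MooreRelations (G := PresentedGroup (relators n)) n (.of .sigma) (.of .tau) where
  sq := PresentedGroup.one_of_mem (.inl <| .inl <| .inl <| .inl <| .inl rfl)
  braid := PresentedGroup.one_of_mem (.inl <| .inl <| .inl <| .inl <| .inr rfl)
  comm m hm hmn := PresentedGroup.one_of_mem (.inl <| .inl <| .inl <| .inr ⟨m, hm, hmn, rfl⟩)
  cycle := PresentedGroup.mk_eq_mk_of_mul_inv_mem (.inl <| .inl <| .inr rfl)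

theorem translationRelations_presentedGroup (n : ℕ) :
    TranslationRelations (G := PresentedGroup (relators n)) n
      (.of .sigma) (.of .tau) (.of .gamma) where
  comm k hk := by
    have := PresentedGroup.mk_eq_mk_of_mul_inv_mem (rels := relators n)
      (.inl <| .inr ⟨k, hk, rfl⟩)
    simp only [map_mul, map_inv, map_pow, mul_assoc] at this
    simpa only [Commute, SemiconjBy, mul_assoc, PresentedGroup.of] using this
  conj_comm l hl hln := by
    have := PresentedGroup.mk_eq_mk_of_mul_inv_mem (rels := relators n)
      (.inr ⟨l, hl, hln, rfl⟩)
    simp only [map_mul, map_inv, map_pow, mul_assoc] at this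
    simpa only [Commute, SemiconjBy, mul_assoc, PresentedGroup.of] using this

end Presentation

theorem mainTheorem5 (n : ℕ) (hn : 4 ≤ n) :
    ∃ e : PresentedGroup (relators n) ≃* LatticeSemidirect n,
      e (PresentedGroup.of Gen.sigma) =
        SemidirectProduct.inr (Equiv.swap (⟨0, by omega⟩ : Fin n) ⟨1, by omega⟩) ∧
      e (PresentedGroup.of Gen.tau) = SemidirectProduct.inr (finRotate n) ∧
      e (PresentedGroup.of Gen.gamma) =
        SemidirectProduct.inl
          (Pi.mulSingle (⟨n - 1, by omega⟩ : Fin n) (Multiplicative.ofAdd (1 : ℤ))) := by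
  let f : PresentedGroup (relators n) →* LatticeSemidirect n :=
    PresentedGroup.toGroup (lift_relators_eq_one
      ((mooreRelations_perm (by omega)).map SemidirectProduct.inr)
      (translationRelations_latticeSemidirect (by omega)))
  have fs : f (.of .sigma) =
      SemidirectProduct.inr (Equiv.swap (⟨0, by omega⟩ : Fin n) ⟨1, by omega⟩) :=
    PresentedGroup.toGroup.of _
  have ft : f (.of .tau) = SemidirectProduct.inr (finRotate n) := PresentedGroup.toGroup.of _
  have fg : f (.of .gamma) = SemidirectProduct.inl
      (Pi.mulSingle (⟨n - 1, by omega⟩ : Fin n) (Multiplicative.ofAdd (1 : ℤ))) :=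
    PresentedGroup.toGroup.of _
  have hM := mooreRelations_presentedGroup n
  have hT := translationRelations_presentedGroup n
  obtain ⟨φ, φs, φt⟩ := hM.exists_hom (by omega) (SemidirectProduct.rightHom.comp f)
    (by simp [fs]) (by simp [ft])
  obtain ⟨Ψ, Ψr, Ψl⟩ := hT.exists_hom (by omega) hM φ φs φt
  have tn : (PresentedGroup.of Gen.tau : PresentedGroup (relators n)) ^ n = 1 := by
    rw [← φt, ← map_pow, finRotate_pow_self, map_one]
  have left : Ψ.comp f = MonoidHom.id _ := by
    refine PresentedGroup.ext fun x => ?_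
    rw [MonoidHom.comp_apply, MonoidHom.id_apply]
    cases x with
    | sigma => rw [fs, Ψr, φs]
    | tau => rw [ft, Ψr, φt]
    | gamma =>
      rw [fg, Ψl]
      simp only [Nat.sub_add_cancel (show 1 ≤ n by omega), tn, one_mul, inv_one, mul_one]
  have right : f.comp Ψ = MonoidHom.id _ := by
    refine SemidirectProduct.hom_ext ?_ ?_
    · refine MonoidHom.pi_ext fun i z => ?_
      have key : f (Ψ (SemidirectProduct.inl
          (Pi.mulSingle i (Multiplicative.ofAdd (1 : ℤ))))) =
          SemidirectProduct.inl (Pi.mulSingle i (Multiplicative.ofAdd (1 : ℤ))) := by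
        -- The cycle's power `i + 1` carries the last coordinate, that of γ, to the `i`-th.
        have hi : (finRotate n ^ (i + 1 : ℕ)) ⟨n - 1, by omega⟩ = i := by
          refine Fin.ext ?_
          rw [val_finRotate_pow]
          simp only [show n - 1 + ((i : ℕ) + 1) = i + n by omega, Nat.add_mod_right,
            Nat.mod_eq_of_lt i.2]
        rw [Ψl, map_mul, map_mul, map_inv, map_pow, ft, fg, ← map_pow,
          inr_mul_inl_mulSingle_mul, hi]
      have hz : (Pi.mulSingle i z : Fin n → Multiplicative ℤ) =
          Pi.mulSingle i (Multiplicative.ofAdd (1 : ℤ)) ^ (Multiplicative.toAdd z) := by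
        rw [← Pi.mulSingle_zpow, ← ofAdd_zsmul]; simp
      rw [hz]
      simp only [MonoidHom.comp_apply, MonoidHom.id_apply, map_zpow, key]
    · refine MonoidHom.eq_of_eqOn_dense (closure_swap_finRotate (n := n) (by omega)) ?_
      rintro _ (rfl | rfl)
      · simp only [MonoidHom.comp_apply, MonoidHom.id_apply, Ψr, φt, ft]
      · simp only [MonoidHom.comp_apply, MonoidHom.id_apply, Ψr, φs, fs]
  exact ⟨MonoidHom.toMulEquiv f Ψ left right, fs, ft, fg⟩
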